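/- For coprime integers $a,b$ with $b>0$ let \[ S(a,b)=12\sum_{k=1}^{b}\left(\!\!\left(\frac kb\right)\!\!\right)\left(\!\!\left(\frac{ak}{b}\right)\!\!\right) \] be the normalized Dedekind sum, where $((x))=\{x\}-\tfrac12$ if $x\notin\mathbb Z$ and $((x))=0$ if $x\in\mathbb Z$. Let $q\ge 2$ be an integer. (1) For all integers $a,t$ with $t>0$, $t\mid a^2+1$ and $\gcd(aq,t)=1$, the number $\frac{(q^2-1)a}{t}-qS(aq,t)$ is an integer. (2) Let $\Lambda_q\subseteq\mathbb Z/(q^2-1)\mathbb Z$ be the set of residues modulo $q^2-1$ of all the integers in (1), and let $\Gamma_q\subseteq\mathbb Z/(q^2-1)\mathbb Z$ be $\{24s: s\in\mathbb Z/(q^2-1)\mathbb Z\}$ if $q$ is a square and $\{12s: s\in\mathbb Z/(q^2-1)\mathbb Z\}$ otherwise. Then $\Lambda_q\subseteq\Gamma_q$. (3) For all integers $a,t,t^*$ with $t>0$, $t\mid a^2+1$ and $tt^*\equiv 1\pmod q$, the number \[ \lambda(a,t,t^*)=\frac{(q^2-1)a}{t}-(q^2-1)at^*-qS(aq,t) \]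 is an integer; it is divisible by $3$ if $3\nmid q$, by $4$ if $q$ is odd, and by $8$ if $q$ is an odd square. -/

import Mathlib

namespace NormalizedDedekind

noncomputable section

open Classical in
/-- The sawtooth function `((x))`. -/
def sawtooth (x : ℝ) : ℝ :=
  if x ∈ Set.range ((↑) : ℤ → ℝ) then 0 else Int.fract x - 1 / 2

/-- The Dedekind sum `s(a,b)`, meant for coprime integers `a`, `b` with `b > 0`. -/
def dedekindSum (a b : ℤ) : ℝ :=
  ∑ k ∈ Finset.Icc 1 b, sawtooth ((k : ℝ) / b) * sawtooth ((a : ℝ) * k / b)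

/-- The normalized Dedekind sum `S(a,b) = 12 s(a,b)`. -/
def S (a b : ℤ) : ℝ := 12 * dedekindSum a b

/-- `λ(a,t,t*) = (q²-1)a/t - (q²-1)a t* - q S(aq,t)`. -/
def lam (q : ℕ) (a t t' : ℤ) : ℝ :=
  ((q : ℝ) ^ 2 - 1) * a / t - ((q : ℝ) ^ 2 - 1) * a * t' - q * S (a * q) t

/-- The set `Λ_q` of residues modulo `q²-1` of the numbers `(q²-1)a/t - q S(aq,t)`, where
`t > 0`, `t ∣ a²+1` and `gcd(aq,t) = 1`. -/
def Lam (q : ℕ) : Set (ZMod (q ^ 2 - 1)) :=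
  {x | ∃ a t n : ℤ, IsCoprime (a * q) t ∧ t ∣ a ^ 2 + 1 ∧ 0 < t ∧
    ((q : ℝ) ^ 2 - 1) * a / t - q * S (a * q) t = n ∧ x = (n : ZMod (q ^ 2 - 1))}

open Classical in
/-- The set `Γ_q`: all multiples of `24` in `ℤ/(q²-1)ℤ` if `q` is a square, and all multiples
of `12` otherwise. -/
def Gam (q : ℕ) : Set (ZMod (q ^ 2 - 1)) :=
  if IsSquare q then {x | ∃ s, x = 24 * s} else {x | ∃ s, x = 12 * s}

end

end NormalizedDedekind

namespace NormalizedDedekind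

/-! The number `N = t * S(aq,t)` is an integer (`dedekindNum`). Modulo `t`, reciprocity gives `aqN ≡
a²q² + 1`; multiplying by `a` and using `a² ≡ -1` gives `qN ≡ (q²-1)a`, which is integrality: `tn =
(q²-1)a - qN`.

Divisibility of `n` comes from that of `q²-1` and `N`, because `3 ∤ t` and `4 ∤ t`. The factor 3 of
`N` is visible in its formula. For odd `t`, the 2-part is Jacobi's congruence `N ≡ t + 1 - 2(aq/t)`
mod 8 with `t ≡ 1` mod 4; if `q` is a square, the symbol is `(a/t) = (2/t)`. For `t = 2m`,
reciprocity moves the congruence to the odd denominator `aq`, and the factor `2m` raises it to mod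
16. Finally, primes dividing `q` are units modulo `q²-1`, so `Γ_q` imposes only the conditions
proved. -/

/-! ### Periodicity and oddness of the sawtooth and of `S`. -/

theorem sawtooth_add_int (x : ℝ) (n : ℤ) : sawtooth (x + n) = sawtooth x := by
  have h : (x + n ∈ Set.range ((↑) : ℤ → ℝ)) ↔ x ∈ Set.range ((↑) : ℤ → ℝ) := by
    constructor
    · rintro ⟨m, hm⟩
      exact ⟨m - n, by push_cast; linarith⟩
    · rintro ⟨m, hm⟩
      exact ⟨m + n, by push_cast; linarith⟩
  classical
  unfold sawtooth
  rw [Int.fract_add_intCast]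
  exact if_congr h rfl rfl

theorem sawtooth_intCast (n : ℤ) : sawtooth n = 0 := by
  simp [sawtooth]

theorem sawtooth_neg (x : ℝ) : sawtooth (-x) = -sawtooth x := by
  by_cases hx : x ∈ Set.range ((↑) : ℤ → ℝ)
  · obtain ⟨m, rfl⟩ := hx
    rw [← Int.cast_neg, sawtooth_intCast, sawtooth_intCast, neg_zero]
  · have hx' : -x ∉ Set.range ((↑) : ℤ → ℝ) := by
      rintro ⟨m, hm⟩
      exact hx ⟨-m, by push_cast; linarith⟩
    have h0 : Int.fract x ≠ 0 := fun h => hx (Int.fract_eq_zero_iff.mp h)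
    simp only [sawtooth, hx, hx', if_false, Int.fract_neg h0]
    ring

theorem S_congr {a b t : ℤ} (ht : 0 < t) (h : a ≡ b [ZMOD t]) : S a t = S b t := by
  obtain ⟨c, hc⟩ := h.dvd
  have ht' : (t : ℝ) ≠ 0 := by exact_mod_cast ht.ne'
  obtain rfl : b = a + t * c := by linarith
  unfold S dedekindSum
  congr 1
  refine Finset.sum_congr rfl fun k _ => ?_
  congr 1
  rw [← sawtooth_add_int _ (c * k)]
  congr 1
  push_cast
  field_simp

theorem S_neg (a t : ℤ) : S (-a) t = -S a t := by
  unfold S dedekindSum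
  rw [← mul_neg, ← Finset.sum_neg_distrib]
  congr 1
  refine Finset.sum_congr rfl fun k _ => ?_
  rw [← mul_neg, ← sawtooth_neg]
  congr 2
  push_cast
  ring

theorem sawtooth_natCast_div (x : ℕ) {b : ℕ} (hb : 0 < b) :
    sawtooth ((x : ℝ) / b) = if x % b = 0 then 0 else ((x % b : ℕ) : ℝ) / b - 1 / 2 := by
  have hb' : (b : ℝ) ≠ 0 := by exact_mod_cast hb.ne'
  have hfr : Int.fract ((x : ℝ) / b) = ((x % b : ℕ) : ℝ) / b :=
    Int.fract_div_natCast_eq_div_natCast_mod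
  have hiff : (x : ℝ) / b ∈ Set.range ((↑) : ℤ → ℝ) ↔ x % b = 0 := by
    change (∃ m : ℤ, (m : ℝ) = _) ↔ _
    have : (∃ m : ℤ, (m : ℝ) = (x : ℝ) / b) ↔ Int.fract ((x : ℝ) / b) = 0 :=
      Int.fract_eq_zero_iff.symm
    rw [this, hfr, div_eq_zero_iff]
    simp only [hb', or_false, Nat.cast_eq_zero]
  classical
  unfold sawtooth
  rw [hfr]
  exact if_congr hiff rfl rfl

/-! ### Floor sums and reciprocity. -/

theorem sum_mul_mod {M : Type*} [AddCommMonoid M] {h k : ℕ} (hk : h.Coprime k) (g : ℕ → M) :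
    ∑ i ∈ Finset.range k, g (h * i % k) = ∑ i ∈ Finset.range k, g i := by
  have hinj : Set.InjOn (fun i => h * i % k) (Finset.range k) := by
    intro i hi j hj hij
    have : i ≡ j [MOD k] := Nat.ModEq.cancel_left_of_coprime hk.symm hij
    simp only [Finset.coe_range, Set.mem_Iio] at hi hj
    exact Nat.ModEq.eq_of_lt_of_lt this hi hj
  have himg : (Finset.range k).image (fun i => h * i % k) = Finset.range k := by
    refine Finset.eq_of_subset_of_card_le ?_ (Finset.card_image_of_injOn hinj).ge
    intro x hx
    obtain ⟨i, hi, rfl⟩ := Finset.mem_image.mp hx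
    exact Finset.mem_range.mpr (Nat.mod_lt _ (Nat.zero_lt_of_lt (Finset.mem_range.mp hi)))
  conv_rhs => rw [← himg, Finset.sum_image hinj]

/-- The integer `k * S(h, k)`, see `S_natCast`. -/
def dedekindNum (h k : ℕ) : ℤ :=
  2 * h * (k - 1) * (2 * k - 1) - 12 * ∑ i ∈ Finset.range k, (i : ℤ) * ((h * i / k : ℕ) : ℤ) -
    3 * k * (k - 1)

theorem sum_range_id_int (k : ℕ) : 2 * ∑ i ∈ Finset.range k, (i : ℤ) = k * (k - 1) := by
  induction k with
  | zero => simp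
  | succ k ih => rw [Finset.sum_range_succ, mul_add, ih]; push_cast; ring

theorem sum_range_sq_int (k : ℕ) :
    6 * ∑ i ∈ Finset.range k, (i : ℤ) ^ 2 = k * (k - 1) * (2 * k - 1) := by
  induction k with
  | zero => simp
  | succ k ih => rw [Finset.sum_range_succ, mul_add, ih]; push_cast; ring

theorem mod_eq_sub_int (h i k : ℕ) :
    ((h * i % k : ℕ) : ℤ) = h * i - k * ((h * i / k : ℕ) : ℤ) := by
  have := Nat.div_add_mod (h * i) k
  have h2 : (k : ℤ) * ((h * i / k : ℕ) : ℤ) + ((h * i % k : ℕ) : ℤ) = h * i := by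
    exact_mod_cast this
  linarith

theorem two_mul_sum_div {h k : ℕ} (hk : h.Coprime k) (hk0 : 0 < k) :
    2 * ∑ i ∈ Finset.range k, ((h * i / k : ℕ) : ℤ) = (h - 1) * (k - 1) := by
  have h1 := sum_mul_mod hk (fun i => (i : ℤ))
  simp only [mod_eq_sub_int, Finset.sum_sub_distrib, ← Finset.mul_sum] at h1
  have h2 := sum_range_id_int k
  have hk' : (k : ℤ) ≠ 0 := by exact_mod_cast hk0.ne'
  apply mul_left_cancel₀ hk'
  linear_combination (-2) * h1 + (h - 1) * h2

/-- Both sides are twice the sum of `j` over the lattice points `(i, j)` with `k * j < h * i`, taken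
by columns and by rows. -/
theorem sum_div_mul_add_one {h k : ℕ} (hk : h.Coprime k) (hk0 : 0 < k) (hh0 : 0 < h) :
    ∑ i ∈ Finset.range k, ((h * i / k : ℕ) : ℤ) * (((h * i / k : ℕ) : ℤ) + 1) =
      2 * ∑ j ∈ Finset.range h, (j : ℤ) * (k - 1 - ((k * j / h : ℕ) : ℤ)) := by
  have e1 : ∀ i ∈ Finset.range k, ((h * i / k : ℕ) : ℤ) * (((h * i / k : ℕ) : ℤ) + 1) =
      2 * ∑ j ∈ Finset.range h, if k * j < h * i then (j : ℤ) else 0 := by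
    intro i hi
    have hi := Finset.mem_range.mp hi
    have hlt : h * i / k < h :=
      (Nat.div_lt_iff_lt_mul hk0).mpr (Nat.mul_lt_mul_of_pos_left hi hh0)
    -- By coprimality the only lattice point on the line `k * j = h * i` is the origin, which has
    -- weight 0.
    have hstrict : ∀ j ∈ Finset.range h,
        (if k * j < h * i then (j : ℤ) else 0) = if k * j ≤ h * i then (j : ℤ) else 0 := by
      intro j _
      rcases lt_trichotomy (k * j) (h * i) with hlt | heq | hgt
      · rw [if_pos hlt, if_pos hlt.le]
      · have hki : k ∣ i := hk.symm.dvd_of_dvd_mul_left ⟨j, heq.symm⟩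
        have hi0 : i = 0 := Nat.eq_zero_of_dvd_of_lt hki hi
        have hj0 : j = 0 := by
          rw [hi0, mul_zero] at heq
          exact (Nat.mul_eq_zero.mp heq).resolve_left hk0.ne'
        simp [hj0]
      · rw [if_neg hgt.not_gt, if_neg hgt.not_ge]
    have hfilter : (Finset.range h).filter (fun j => k * j ≤ h * i) =
        Finset.range (h * i / k + 1) := by
      ext j
      simp only [Finset.mem_filter, Finset.mem_range, Nat.lt_succ_iff, Nat.le_div_iff_mul_le hk0,
        mul_comm j k]
      refine ⟨fun hj => hj.2, fun hj => ⟨?_, hj⟩⟩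
      exact lt_of_le_of_lt ((Nat.le_div_iff_mul_le hk0).mpr (by rwa [mul_comm])) hlt
    rw [Finset.sum_congr rfl hstrict, ← Finset.sum_filter, hfilter, sum_range_id_int]
    push_cast
    ring
  have e2 : ∀ j ∈ Finset.range h, (j : ℤ) * (k - 1 - ((k * j / h : ℕ) : ℤ)) =
      ∑ i ∈ Finset.range k, if k * j < h * i then (j : ℤ) else 0 := by
    intro j hj
    have hj := Finset.mem_range.mp hj
    rw [← Finset.sum_filter, Finset.sum_const]
    have : (Finset.range k).filter (fun i => k * j < h * i) = Finset.Ico (k * j / h + 1) k := by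
      ext i
      simp only [Finset.mem_filter, Finset.mem_range, Finset.mem_Ico, Nat.succ_le_iff,
        Nat.div_lt_iff_lt_mul hh0, mul_comm i h]
      tauto
    have hlt : k * j / h < k := (Nat.div_lt_iff_lt_mul hh0).mpr (Nat.mul_lt_mul_of_pos_left hj hk0)
    rw [this, Nat.card_Ico, nsmul_eq_mul, Nat.cast_sub (by omega)]
    push_cast
    ring
  rw [Finset.sum_congr rfl e1, Finset.sum_congr rfl e2, ← Finset.mul_sum, Finset.sum_comm]

/-- Multiplication by `h` permutes the residues mod `k`, so the squares of `h * i % k` sum to `∑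
i²`. Expanding them produces `∑ ⌊hi/k⌋²`, which the lattice point count trades for the floor sum of
`dedekindNum k h`. -/
theorem reciprocity {h k : ℕ} (hk : h.Coprime k) (hk0 : 0 < k) (hh0 : 0 < h) :
    h * dedekindNum h k + k * dedekindNum k h = h ^ 2 + k ^ 2 + 1 - 3 * h * k := by
  have h1 := sum_mul_mod hk (fun i => (i : ℤ) ^ 2)
  have h2 := two_mul_sum_div hk hk0
  have h3 := sum_div_mul_add_one hk hk0 hh0
  have h4 := sum_range_sq_int k
  have h5 := sum_range_id_int h
  have h6 : ∀ i : ℕ, ((h * i % k : ℕ) : ℤ) ^ 2 = h ^ 2 * (i : ℤ) ^ 2 -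
      2 * h * k * (i * ((h * i / k : ℕ) : ℤ)) + k ^ 2 * ((h * i / k : ℕ) : ℤ) ^ 2 := by
    intro i
    rw [mod_eq_sub_int]
    ring
  simp only [h6, Finset.sum_add_distrib, Finset.sum_sub_distrib, ← Finset.mul_sum] at h1
  simp only [mul_add, mul_sub, mul_one, Finset.sum_add_distrib, Finset.sum_sub_distrib,
    ← Finset.sum_mul, ← sq] at h3
  unfold dedekindNum
  have hk' : (k : ℤ) ≠ 0 := by exact_mod_cast hk0.ne'
  apply mul_left_cancel₀ hk'
  linear_combination 6 * h1 - 6 * (k : ℤ) ^ 2 * h3 + 3 * (k : ℤ) ^ 2 * h2 -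
    6 * (k : ℤ) ^ 2 * (k - 1) * h5 - ((h : ℤ) ^ 2 - 1) * h4

/-! ### Identification of `dedekindNum` with `k * S(h,k)`. -/

theorem sum_Icc_eq_sum_range {M : Type*} [AddCommGroup M] (f : ℤ → M) (b : ℕ) (h : f b = f 0) :
    ∑ k ∈ Finset.Icc (1 : ℤ) b, f k = ∑ k ∈ Finset.range b, f k := by
  have h1 : ∑ k ∈ Finset.Icc (1 : ℤ) b, f k = ∑ k ∈ Finset.range b, f ((k + 1 : ℕ) : ℤ) := by
    symm
    refine Finset.sum_nbij' (fun k => ((k + 1 : ℕ) : ℤ)) (fun k => k.toNat - 1) ?_ ?_ ?_ ?_ ?_ <;>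
      intro k hk <;> simp only [Finset.mem_range, Finset.mem_Icc] at * <;> omega
  have h2 := Finset.sum_range_succ' (fun k : ℕ => f k) b
  rw [Finset.sum_range_succ, h, Nat.cast_zero] at h2
  rw [h1]
  exact (add_right_cancel h2).symm

theorem S_natCast {h k : ℕ} (hk : h.Coprime k) (hk0 : 0 < k) :
    S h k = (dedekindNum h k : ℝ) / k := by
  have hk' : (k : ℝ) ≠ 0 := by exact_mod_cast hk0.ne'
  have e0 : sawtooth 0 = 0 := by simpa using sawtooth_intCast 0
  -- At `i = 0` the sawtooth is 0, but the expanded product of `{x} - 1/2` terms gives `1/4`; the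
  -- last term removes it.
  have e1 : dedekindSum h k = ∑ i ∈ Finset.range k,
      ((i : ℝ) / k * (((h * i % k : ℕ) : ℝ) / k - 1 / 2) -
        1 / 2 * (((h * i % k : ℕ) : ℝ) / k - 1 / 2) - if i = 0 then 1 / 4 else 0) := by
    unfold dedekindSum
    rw [sum_Icc_eq_sum_range _ _ (by
      have : sawtooth 1 = 0 := by simpa using sawtooth_intCast 1
      simp [hk', this, e0])]
    refine Finset.sum_congr rfl fun i hi => ?_
    have hi := Finset.mem_range.mp hi
    have e2 : ((h : ℤ) : ℝ) * ((i : ℤ) : ℝ) / ((k : ℤ) : ℝ) = ((h * i : ℕ) : ℝ) / k := by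
      push_cast
      rfl
    rw [e2, sawtooth_natCast_div _ hk0]
    simp only [Int.cast_natCast]
    rw [sawtooth_natCast_div _ hk0, Nat.mod_eq_of_lt hi]
    by_cases hi0 : i = 0
    · subst hi0
      norm_num
    · have : h * i % k ≠ 0 := fun h0 => hi0 (Nat.eq_zero_of_dvd_of_lt
        (hk.symm.dvd_of_dvd_mul_left (Nat.dvd_of_mod_eq_zero h0)) hi)
      rw [if_neg hi0, if_neg this, if_neg hi0]
      ring
  have e3 := congrArg (Int.cast : ℤ → ℝ) (sum_mul_mod hk (fun i => (i : ℤ)))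
  have e4 := congrArg (Int.cast : ℤ → ℝ) (sum_range_id_int k)
  have e5 := congrArg (Int.cast : ℤ → ℝ) (sum_range_sq_int k)
  have e6 : ∑ i ∈ Finset.range k, (i : ℝ) * ((h * i % k : ℕ) : ℝ) =
      h * ∑ i ∈ Finset.range k, (i : ℝ) ^ 2 -
        k * ∑ i ∈ Finset.range k, (i : ℝ) * ((h * i / k : ℕ) : ℝ) := by
    rw [Finset.mul_sum, Finset.mul_sum, ← Finset.sum_sub_distrib]
    refine Finset.sum_congr rfl fun i _ => ?_
    have := congrArg (Int.cast : ℤ → ℝ) (mod_eq_sub_int h i k)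
    simp only [Int.cast_natCast, Int.cast_sub, Int.cast_mul] at this
    rw [this]
    ring
  have e7 : dedekindSum h k = (∑ i ∈ Finset.range k, (i : ℝ) * ((h * i % k : ℕ) : ℝ)) / k ^ 2 -
      (∑ i ∈ Finset.range k, (i : ℝ)) / (2 * k) -
      (∑ i ∈ Finset.range k, ((h * i % k : ℕ) : ℝ)) / (2 * k) + k / 4 - 1 / 4 := by
    rw [e1, Finset.sum_sub_distrib, Finset.sum_ite_eq', if_pos (Finset.mem_range.mpr hk0)]
    have : (k : ℝ) / 4 = ∑ i ∈ Finset.range k, (1 / 4 : ℝ) := by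
      simp
      ring
    rw [this, Finset.sum_div, Finset.sum_div, Finset.sum_div, ← Finset.sum_sub_distrib,
      ← Finset.sum_sub_distrib, ← Finset.sum_add_distrib]
    congr 1
    refine Finset.sum_congr rfl fun i _ => ?_
    field_simp
    ring
  simp only [Int.cast_sum, Int.cast_mul, Int.cast_pow, Int.cast_natCast, Int.cast_sub,
    Int.cast_one, Int.cast_ofNat] at e3 e4 e5
  unfold S dedekindNum
  rw [e7, e3, e6]
  simp only [Int.cast_sum, Int.cast_mul, Int.cast_natCast, Int.cast_sub,
    Int.cast_one, Int.cast_ofNat]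
  rw [eq_div_iff hk']
  generalize ∑ i ∈ Finset.range k, (i : ℝ) = X at *
  generalize ∑ i ∈ Finset.range k, (i : ℝ) ^ 2 = Y at *
  generalize ∑ i ∈ Finset.range k, (i : ℝ) * ((h * i / k : ℕ) : ℝ) = Z at *
  field_simp
  linear_combination 16 * (h : ℝ) * e5 - 48 * (k : ℝ) * e4

theorem S_natCast_mul {h k : ℕ} (hk : h.Coprime k) (hk0 : 0 < k) :
    S h k * k = dedekindNum h k := by
  rw [S_natCast hk hk0, div_mul_cancel₀ _ (by exact_mod_cast hk0.ne')]

theorem dedekindNum_mod {h k : ℕ} (hk : h.Coprime k) (hk0 : 0 < k) :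
    dedekindNum (h % k) k = dedekindNum h k := by
  have hk' : (h % k).Coprime k := (Nat.gcd_rec k h).symm.trans hk.symm
  have hS : S ((h % k : ℕ) : ℤ) k = S h k :=
    S_congr (by exact_mod_cast hk0) (by push_cast; exact Int.mod_modEq _ _)
  have := S_natCast_mul hk hk0
  rw [← hS, S_natCast_mul hk' hk0] at this
  exact_mod_cast this

theorem dedekindNum_sub {h k : ℕ} (hk : h.Coprime k) (hk0 : 0 < k) (hle : h ≤ k) :
    dedekindNum (k - h) k = -dedekindNum h k := by
  have hk' : (k - h).Coprime k := by
    rw [Nat.coprime_comm, Nat.coprime_self_sub_right hle]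
    exact hk.symm
  have hS : S ((k - h : ℕ) : ℤ) k = -S h k := by
    rw [← S_neg]
    refine S_congr (by exact_mod_cast hk0) (Int.modEq_iff_dvd.mpr ⟨-1, ?_⟩)
    push_cast [hle]
    ring
  have := S_natCast_mul hk' hk0
  rw [hS, neg_mul, S_natCast_mul hk hk0] at this
  exact_mod_cast this.symm

/-! ### Jacobi's congruence modulo 8. -/

theorem natCast_zmod_eight_of_odd {n : ℕ} (hn : Odd n) :
    (n % 4 = 1 ∧ ((n : ZMod 8) = 1 ∨ (n : ZMod 8) = 5)) ∨
      (n % 4 = 3 ∧ ((n : ZMod 8) = 3 ∨ (n : ZMod 8) = 7)) := by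
  have h1 : (n : ZMod 8) = ((n % 8 : ℕ) : ZMod 8) := (ZMod.natCast_mod n 8).symm
  have h2 := Nat.odd_iff.mp hn
  have h3 : n % 8 = 1 ∨ n % 8 = 3 ∨ n % 8 = 5 ∨ n % 8 = 7 := by omega
  rcases h3 with h | h | h | h <;> rw [h1, h]
  · exact Or.inl ⟨by omega, Or.inl (by decide)⟩
  · exact Or.inr ⟨by omega, Or.inl (by decide)⟩
  · exact Or.inl ⟨by omega, Or.inr (by decide)⟩
  · exact Or.inr ⟨by omega, Or.inr (by decide)⟩

/-- Jacobi's congruence relating Dedekind sums and the Jacobi symbol. -/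
theorem dedekindNum_zmod_eight (k : ℕ) : ∀ h : ℕ, h.Coprime k → Odd k →
    (dedekindNum h k : ZMod 8) = k + 1 - 2 * (jacobiSym h k : ZMod 8) := by
  induction k using Nat.strong_induction_on with
  | _ k ih =>
  -- odd numerators below the denominator: reciprocity
  have hodd : ∀ h : ℕ, h < k → h.Coprime k → Odd h → Odd k →
      (dedekindNum h k : ZMod 8) = k + 1 - 2 * (jacobiSym h k : ZMod 8) := by
    intro h hlt hk hh hk1
    have hr := congrArg (Int.cast : ℤ → ZMod 8) (reciprocity hk hk1.pos hh.pos)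
    have hi := ih h hlt k hk.symm hh
    have hj : jacobiSym k h = 1 ∨ jacobiSym k h = -1 :=
      jacobiSym.eq_one_or_neg_one (by simpa using hk.symm)
    push_cast at hr
    rw [hi] at hr
    generalize (dedekindNum h k : ZMod 8) = x at *
    -- The odd `h` is a unit mod 8, so `hr` determines `x`; quadratic reciprocity leaves finitely
    -- many cases.
    rcases natCast_zmod_eight_of_odd hh with ⟨h4, hh8⟩ | ⟨h4, hh8⟩
    · rw [jacobiSym.quadratic_reciprocity_one_mod_four h4 hk1]
      rcases natCast_zmod_eight_of_odd hk1 with ⟨-, hk8⟩ | ⟨-, hk8⟩ <;>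
      rcases hh8 with hh8 | hh8 <;> rcases hk8 with hk8 | hk8 <;> rcases hj with hj | hj <;>
      rw [hh8, hk8, hj] at hr <;> rw [hk8, hj] <;> revert x <;> decide
    · rcases natCast_zmod_eight_of_odd hk1 with ⟨k4, hk8⟩ | ⟨k4, hk8⟩
      · rw [jacobiSym.quadratic_reciprocity_one_mod_four' hh k4]
        rcases hh8 with hh8 | hh8 <;> rcases hk8 with hk8 | hk8 <;> rcases hj with hj | hj <;>
        rw [hh8, hk8, hj] at hr <;> rw [hk8, hj] <;> revert x <;> decide
      · rw [jacobiSym.quadratic_reciprocity_three_mod_four h4 k4]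
        rcases hh8 with hh8 | hh8 <;> rcases hk8 with hk8 | hk8 <;> rcases hj with hj | hj <;>
        rw [hh8, hk8, hj] at hr <;> rw [hk8, hj] <;> revert x <;> decide
  have hlt : ∀ h : ℕ, h < k → h.Coprime k → Odd k →
      (dedekindNum h k : ZMod 8) = k + 1 - 2 * (jacobiSym h k : ZMod 8) := by
    intro h hlt hk hk1
    rcases Nat.even_or_odd h with he | ho
    · rcases Nat.eq_zero_or_pos h with rfl | hpos
      · obtain rfl : k = 1 := by simpa using hk
        simp [dedekindNum]
        decide
      -- For even `h`, `k - h` is odd and congruent to `-h`; the numerator changes sign and the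
      -- symbol gains `χ₄ k`.
      · have hk' : (k - h).Coprime k := by
          rw [Nat.coprime_comm, Nat.coprime_self_sub_right hlt.le]
          exact hk.symm
        have hs := hodd (k - h) (by omega) hk' (Nat.Odd.sub_even hlt.le hk1 he) hk1
        have hJ : jacobiSym ((k - h : ℕ) : ℤ) k = ZMod.χ₄ k * jacobiSym h k := by
          rw [← jacobiSym.neg _ hk1, jacobiSym.mod_left, jacobiSym.mod_left (-(h : ℤ))]
          congr 1
          rw [Nat.cast_sub hlt.le]
          exact Int.ModEq.eq (Int.modEq_iff_dvd.mpr ⟨-1, by ring⟩)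
        have hj : jacobiSym h k = 1 ∨ jacobiSym h k = -1 :=
          jacobiSym.eq_one_or_neg_one (by simpa using hk)
        rw [dedekindNum_sub hk hk1.pos hlt.le, hJ] at hs
        push_cast at hs
        generalize (dedekindNum h k : ZMod 8) = x at *
        rcases natCast_zmod_eight_of_odd hk1 with ⟨k4, hk8⟩ | ⟨k4, hk8⟩
        · rw [ZMod.χ₄_nat_one_mod_four k4] at hs
          rcases hk8 with hk8 | hk8 <;> rcases hj with hj | hj <;>
          rw [hk8, hj] at hs <;> rw [hk8, hj] <;> revert x <;> decide
        · rw [ZMod.χ₄_nat_three_mod_four k4] at hs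
          rcases hk8 with hk8 | hk8 <;> rcases hj with hj | hj <;>
          rw [hk8, hj] at hs <;> rw [hk8, hj] <;> revert x <;> decide
    · exact hodd h hlt hk ho hk1
  intro h hk hk1
  have hk' : (h % k).Coprime k := (Nat.gcd_rec k h).symm.trans hk.symm
  have := hlt (h % k) (Nat.mod_lt _ hk1.pos) hk' hk1
  rw [dedekindNum_mod hk hk1.pos] at this
  rw [this, jacobiSym.mod_left (h : ℤ), Int.natCast_mod]

/-! ### The factor 3, and divisors of `a² + 1`. -/

theorem three_dvd_dedekindNum {h k : ℕ} (hk3 : ¬ 3 ∣ k) : 3 ∣ dedekindNum h k := by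
  have h1 : (3 : ℤ) ∣ ((k : ℤ) - 1) * (2 * k - 1) := by
    have : k % 3 = 1 ∨ k % 3 = 2 := by omega
    rcases this with h | h
    · exact Dvd.dvd.mul_right (by omega) _
    · exact Dvd.dvd.mul_left (by omega) _
  obtain ⟨c, hc⟩ := h1
  refine ⟨2 * h * c - 4 * ∑ i ∈ Finset.range k, (i : ℤ) * ((h * i / k : ℕ) : ℤ) -
    k * (k - 1), ?_⟩
  unfold dedekindNum
  linear_combination 2 * (h : ℤ) * hc

/-- `2 * a ≡ (1 + a) ^ 2` modulo a divisor of `a ^ 2 + 1`. -/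
theorem jacobiSym_eq_χ₈_of_dvd_sq_add_one {a : ℤ} {t : ℕ} (ht : Odd t) (h : (t : ℤ) ∣ a ^ 2 + 1) :
    jacobiSym a t = ZMod.χ₈ t := by
  have h2 : IsCoprime (2 : ℤ) t := by
    exact_mod_cast Nat.isCoprime_iff_coprime.mpr (Nat.coprime_two_left.mpr ht)
  obtain ⟨u, hu⟩ := h
  have ha : IsCoprime a t := ⟨-a, u, by linear_combination -hu⟩
  have h1a : IsCoprime (1 + a) t := by
    have h2a : IsCoprime ((1 + a) ^ 2) (t : ℤ) := by
      have : (1 + a) ^ 2 = 2 * a + u * t := by linear_combination hu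
      rw [this]
      exact (h2.mul_left ha).add_mul_right_left u
    exact (IsCoprime.pow_left_iff two_pos).mp h2a
  have e : jacobiSym (2 * a) t = jacobiSym ((1 + a) ^ 2) t := by
    rw [jacobiSym.mod_left, jacobiSym.mod_left ((1 + a) ^ 2)]
    congr 1
    exact Int.ModEq.eq (Int.modEq_iff_dvd.mpr ⟨u, by linear_combination hu⟩)
  rw [jacobiSym.sq_one' (Int.isCoprime_iff_gcd_eq_one.mp h1a), jacobiSym.mul_left,
    jacobiSym.at_two ht] at e
  rw [← jacobiSym.at_two ht] at *
  have hj : jacobiSym 2 t = 1 ∨ jacobiSym 2 t = -1 :=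
    jacobiSym.eq_one_or_neg_one (Int.isCoprime_iff_gcd_eq_one.mp h2)
  rcases hj with hj | hj <;> rw [hj] at e ⊢ <;> linarith

/-- `-1` is the square of `a` modulo `t`, so `χ₄ t = (-1/t) = 1`. -/
theorem mod_four_eq_one_of_dvd_sq_add_one {a : ℤ} {t : ℕ} (ht : Odd t)
    (h : (t : ℤ) ∣ a ^ 2 + 1) : t % 4 = 1 := by
  obtain ⟨u, hu⟩ := h
  have ha : IsCoprime a t := ⟨-a, u, by linear_combination -hu⟩
  have e : jacobiSym (-1) t = jacobiSym (a ^ 2) t := by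
    rw [jacobiSym.mod_left, jacobiSym.mod_left (a ^ 2)]
    congr 1
    exact Int.ModEq.eq (Int.modEq_iff_dvd.mpr ⟨u, by linear_combination hu⟩)
  rw [jacobiSym.sq_one' (Int.isCoprime_iff_gcd_eq_one.mp ha), jacobiSym.at_neg_one ht] at e
  rcases Nat.odd_mod_four_iff.mp (Nat.odd_iff.mp ht) with h4 | h4
  · exact h4
  · rw [ZMod.χ₄_nat_three_mod_four h4] at e
    norm_num at e

theorem not_three_dvd_sq_add_one (a : ℤ) : ¬ 3 ∣ a ^ 2 + 1 := by
  intro h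
  have h1 : ((a ^ 2 + 1 : ℤ) : ZMod 3) = 0 := (ZMod.intCast_zmod_eq_zero_iff_dvd _ 3).mpr h
  push_cast at h1
  generalize (a : ZMod 3) = x at h1
  revert x
  decide

theorem not_four_dvd_sq_add_one (a : ℤ) : ¬ 4 ∣ a ^ 2 + 1 := by
  intro h
  have h1 : ((a ^ 2 + 1 : ℤ) : ZMod 4) = 0 := (ZMod.intCast_zmod_eq_zero_iff_dvd _ 4).mpr h
  push_cast at h1
  generalize (a : ZMod 4) = x at h1
  revert x
  decide

/-! ### Even denominators, modulo 16. -/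

/-- An odd square is 1 or 9 mod 16 as `n` is `±1` or `±3` mod 8. Writing this linearly in `χ₈` lets
it combine with Jacobi symbols. -/
theorem odd_natCast_zmod_sixteen {n : ℕ} (hn : Odd n) :
    (n : ZMod 16) ^ 2 = 5 - 4 * ((ZMod.χ₈ n : ℤ) : ZMod 16) ∧ (n : ZMod 16) ^ 4 = 1 ∧
      8 * (n : ZMod 16) = 8 := by
  have h1 : (n : ZMod 16) = ((n % 16 : ℕ) : ZMod 16) := (ZMod.natCast_mod n 16).symm
  have h2 : (n : ZMod 8) = ((n % 16 : ℕ) : ZMod 8) := by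
    rw [← ZMod.natCast_mod n 8, ← ZMod.natCast_mod (n % 16) 8]
    congr 1
    omega
  have h3 := Nat.odd_iff.mp hn
  have h4 : n % 16 < 16 := Nat.mod_lt _ (by norm_num)
  have h5 : n % 16 % 2 = 1 := by omega
  rw [h1, h2]
  generalize n % 16 = r at h4 h5
  clear h1 h2 h3
  interval_cases r <;> first | omega | decide

theorem natCast_zmod_sixteen_of_mod_four_eq_one {n : ℕ} (hn : n % 4 = 1) :
    2 * (n : ZMod 16) = 6 - 4 * ((ZMod.χ₈ n : ℤ) : ZMod 16) ∧ 4 * (n : ZMod 16) = 4 := by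
  have h1 : (n : ZMod 16) = ((n % 16 : ℕ) : ZMod 16) := (ZMod.natCast_mod n 16).symm
  have h2 : (n : ZMod 8) = ((n % 16 : ℕ) : ZMod 8) := by
    rw [← ZMod.natCast_mod n 8, ← ZMod.natCast_mod (n % 16) 8]
    congr 1
    omega
  have h4 : n % 16 < 16 := Nat.mod_lt _ (by norm_num)
  have h5 : n % 16 % 4 = 1 := by omega
  rw [h1, h2]
  generalize n % 16 = r at h4 h5
  clear h1 h2
  interval_cases r <;> first | omega | decide

theorem χ₈_natCast_of_odd {n : ℕ} (hn : Odd n) : ZMod.χ₈ n = 1 ∨ ZMod.χ₈ n = -1 := by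
  have h := Nat.odd_iff.mp hn
  rw [ZMod.χ₈_nat_eq_if_mod_eight, if_neg (by omega)]
  split_ifs <;> simp

/-- Reciprocity brings in `2 * m * dedekindNum (2 * m) c`, where the denominator `c` is odd;
Jacobi's congruence mod 8 times `2 * m` holds mod 16. The factor `c` is harmless, being odd. -/
theorem mul_dedekindNum_two_mul {c m : ℕ} (hc : c.Coprime (2 * m)) (hm : 0 < m) (hodd : Odd c) :
    ∃ u : ℤ, c * dedekindNum c (2 * m) = c ^ 2 + 4 * m ^ 2 + 1 - 8 * c * m - 2 * m +
      4 * m * jacobiSym ((2 * m : ℕ) : ℤ) c + 16 * u := by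
  have h1 := dedekindNum_zmod_eight c (2 * m) hc.symm hodd
  have h2 : (8 : ℤ) ∣ dedekindNum (2 * m) c -
      (c + 1 - 2 * jacobiSym ((2 * m : ℕ) : ℤ) c) := by
    refine (ZMod.intCast_zmod_eq_zero_iff_dvd _ 8).mp ?_
    push_cast at h1 ⊢
    rw [h1, sub_self]
  obtain ⟨v, hv⟩ := h2
  have hr := reciprocity hc (by omega) hodd.pos
  refine ⟨-m * v, ?_⟩
  push_cast at hr hv ⊢
  linear_combination hr - 2 * (m : ℤ) * hv

theorem isCoprime_two_pow_of_odd {n : ℤ} (hn : Odd n) (e : ℕ) : IsCoprime ((2 : ℤ) ^ e) n :=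
  (Int.isCoprime_two_left.mpr hn).pow_left

theorem eight_dvd_dedekindNum {c m : ℕ} (hc : c.Coprime (2 * m)) (hm : m % 4 = 1)
    (hodd : Odd c) : 8 ∣ dedekindNum c (2 * m) := by
  obtain ⟨u, hu⟩ := mul_dedekindNum_two_mul hc (by omega) hodd
  have hodd' : Odd (c : ℤ) := by exact_mod_cast hodd
  have hj : jacobiSym ((2 * m : ℕ) : ℤ) c = 1 ∨ jacobiSym ((2 * m : ℕ) : ℤ) c = -1 :=
    jacobiSym.eq_one_or_neg_one (by
      rw [Int.gcd_natCast_natCast]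
      exact hc.symm)
  obtain ⟨w, hw⟩ := Int.eight_dvd_sq_sub_one_of_odd hodd'
  obtain ⟨v, hv⟩ : ∃ v : ℤ, (m : ℤ) = 4 * v + 1 := ⟨m / 4, by omega⟩
  refine (isCoprime_two_pow_of_odd hodd' 3).dvd_of_dvd_mul_left ?_
  rw [hu]
  rcases hj with hj | hj <;> rw [hj, hv]
  · exact ⟨w + 8 * v ^ 2 + 4 * v + 1 - c * (4 * v + 1) + v + 2 * u, by linear_combination hw⟩
  · exact ⟨w + 8 * v ^ 2 + 4 * v - c * (4 * v + 1) - 3 * v + 2 * u, by linear_combination hw⟩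

theorem sixteen_dvd_dedekindNum {a s m : ℕ} (hc : (a * (s * s)).Coprime (2 * m)) (hm : m % 4 = 1)
    (ha : Odd a) (hs : Odd s) (hdvd : (m : ℤ) ∣ (a : ℤ) ^ 2 + 1) :
    16 ∣ dedekindNum (a * (s * s)) (2 * m) := by
  have hodd : Odd (a * (s * s)) := ha.mul (hs.mul hs)
  have hm2 : Odd m := Nat.odd_iff.mpr (by omega)
  obtain ⟨u, hu⟩ := mul_dedekindNum_two_mul hc (by omega) hodd
  have hodd' : Odd ((a * (s * s) : ℕ) : ℤ) := by exact_mod_cast hodd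
  have hs1 : jacobiSym ((2 * m : ℕ) : ℤ) s ^ 2 = 1 := jacobiSym.sq_one (by
    rw [Int.gcd_natCast_natCast]
    exact (hc.coprime_dvd_left ⟨a * s, by ring⟩).symm)
  -- The square drops out, and `(2m/a) = (2/a)(m/a)` with `(m/a) = (a/m) = (2/m)`, as `m ≡ 1` mod 4
  -- divides `a² + 1`.
  have hJ : jacobiSym ((2 * m : ℕ) : ℤ) (a * (s * s)) = ZMod.χ₈ a * ZMod.χ₈ m := by
    rw [jacobiSym.mul_right' _ ha.pos.ne' (hs.mul hs).pos.ne',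
      jacobiSym.mul_right' _ hs.pos.ne' hs.pos.ne', ← sq, hs1, mul_one, Nat.cast_mul,
      jacobiSym.mul_left, Nat.cast_two, jacobiSym.at_two ha,
      jacobiSym.quadratic_reciprocity_one_mod_four hm ha,
      jacobiSym_eq_χ₈_of_dvd_sq_add_one hm2 hdvd]
  refine (isCoprime_two_pow_of_odd hodd' 4).dvd_of_dvd_mul_left ?_
  refine (ZMod.intCast_zmod_eq_zero_iff_dvd _ 16).mp ?_
  rw [hu, hJ]
  obtain ⟨a2, -, -⟩ := odd_natCast_zmod_sixteen ha
  obtain ⟨-, s4, -⟩ := odd_natCast_zmod_sixteen hs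
  obtain ⟨-, -, c8⟩ := odd_natCast_zmod_sixteen hodd
  obtain ⟨m2, m4⟩ := natCast_zmod_sixteen_of_mod_four_eq_one hm
  have h16 : (16 : ZMod 16) = 0 := by decide
  push_cast at c8 ⊢
  -- The expression is `4(1 + x)(y - 1)`, with both factors even.
  have key : ∀ x y : ℤ, (x = 1 ∨ x = -1) → (y = 1 ∨ y = -1) →
      (-4 - 4 * x + 4 * y + 4 * (x * y) : ZMod 16) = 0 := by
    rintro x y (rfl | rfl) (rfl | rfl) <;> decide
  have := key _ _ (χ₈_natCast_of_odd ha) (χ₈_natCast_of_odd hm2)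
  linear_combination this + a2 + (a : ZMod 16) ^ 2 * s4 + (m : ZMod 16) * m4 + m4 -
    (m : ZMod 16) * c8 - 2 * m4 - m2 +
    ((ZMod.χ₈ a : ℤ) : ZMod 16) * ((ZMod.χ₈ m : ℤ) : ZMod 16) * m4 + u * h16

/-! ### The numerator of `S(aq,t)`. -/

/-- The divisibility properties of the numerator of `S (a * q) t` for `t ∣ a ^ 2 + 1`. -/
theorem dedekindNum_properties {a q t : ℕ} (ha : 0 < a) (hq : 0 < q) (ht : 0 < t)
    (hdvd : (t : ℤ) ∣ (a : ℤ) ^ 2 + 1) (hc : (a * q).Coprime t) :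
    (t : ℤ) ∣ ((q : ℤ) ^ 2 - 1) * a - q * dedekindNum (a * q) t ∧
    3 ∣ dedekindNum (a * q) t ∧
    (Odd q → Odd t → 4 ∣ dedekindNum (a * q) t) ∧
    (Odd q → Even t → 8 ∣ dedekindNum (a * q) t) ∧
    (Odd q → IsSquare q → Odd t → 8 ∣ dedekindNum (a * q) t) ∧
    (Odd q → IsSquare q → Even t → 16 ∣ dedekindNum (a * q) t) := by
  have heven : Even t → ∃ m, t = 2 * m ∧ m % 4 = 1 ∧ (m : ℤ) ∣ (a : ℤ) ^ 2 + 1 ∧ Odd a := by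
    rintro ⟨m, rfl⟩
    have hm : (m : ℤ) ∣ (a : ℤ) ^ 2 + 1 := (Dvd.intro_left 2 (by push_cast; ring)).trans hdvd
    have hodd : Odd m := by
      by_contra h
      obtain ⟨r, rfl⟩ := Nat.not_odd_iff_even.mp h
      refine not_four_dvd_sq_add_one (a : ℤ) (Dvd.dvd.trans ⟨r, ?_⟩ hdvd)
      push_cast
      ring
    refine ⟨m, by ring, mod_four_eq_one_of_dvd_sq_add_one hodd hm, hm, ?_⟩
    have : (a * q).Coprime 2 := hc.coprime_dvd_right ⟨m, by ring⟩
    exact Nat.coprime_two_right.mp (this.coprime_dvd_left ⟨q, rfl⟩)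
  have hjac : Odd t → (dedekindNum (a * q) t : ZMod 8) =
      t + 1 - 2 * (jacobiSym ((a * q : ℕ) : ℤ) t : ZMod 8) :=
    dedekindNum_zmod_eight t (a * q) hc
  refine ⟨?_, ?_, ?_, ?_, ?_, ?_⟩
  -- Reciprocity is reduced mod `t` after multiplication by `a`, with `a² ≡ -1`.
  · have hr := reciprocity hc ht (Nat.mul_pos ha hq)
    obtain ⟨u, hu⟩ := hdvd
    refine ⟨a * (t + q ^ 2 * u - dedekindNum t (a * q) - 3 * (a * q)) -
      u * (q * dedekindNum (a * q) t), ?_⟩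
    push_cast at hr
    linear_combination (a : ℤ) * hr +
      (a * (q : ℤ) ^ 2 - q * dedekindNum (a * q) t) * hu
  · refine three_dvd_dedekindNum fun h3 => not_three_dvd_sq_add_one (a : ℤ) (Dvd.dvd.trans ?_ hdvd)
    exact_mod_cast h3
  · intro _ ht2
    have h4 := mod_four_eq_one_of_dvd_sq_add_one ht2 hdvd
    have hj : jacobiSym ((a * q : ℕ) : ℤ) t = 1 ∨ jacobiSym ((a * q : ℕ) : ℤ) t = -1 :=
      jacobiSym.eq_one_or_neg_one (by rw [Int.gcd_natCast_natCast]; exact hc)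
    have h8 : (8 : ℤ) ∣ dedekindNum (a * q) t - (t + 1 - 2 * jacobiSym ((a * q : ℕ) : ℤ) t) := by
      refine (ZMod.intCast_zmod_eq_zero_iff_dvd _ 8).mp ?_
      have := hjac ht2
      push_cast at this ⊢
      rw [this, sub_self]
    rcases hj with hj | hj <;> rw [hj] at h8 <;> omega
  · intro hq2 ht2
    obtain ⟨m, rfl, hm, -, ha2⟩ := heven ht2
    exact eight_dvd_dedekindNum hc hm (ha2.mul hq2)
  · rintro _ ⟨s, rfl⟩ ht2
    have h4 := mod_four_eq_one_of_dvd_sq_add_one ht2 hdvd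
    have hs1 : jacobiSym (s : ℤ) t ^ 2 = 1 := jacobiSym.sq_one (by
      rw [Int.gcd_natCast_natCast]
      exact hc.coprime_dvd_left ⟨a * s, by ring⟩)
    have hJ : jacobiSym ((a * (s * s) : ℕ) : ℤ) t = ZMod.χ₈ t := by
      rw [Nat.cast_mul, Nat.cast_mul, jacobiSym.mul_left, jacobiSym.mul_left, ← sq, hs1, mul_one,
        jacobiSym_eq_χ₈_of_dvd_sq_add_one ht2 hdvd]
    have h8 : (8 : ℤ) ∣ dedekindNum (a * (s * s)) t - (t + 1 - 2 * ZMod.χ₈ t) := by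
      refine (ZMod.intCast_zmod_eq_zero_iff_dvd _ 8).mp ?_
      have := hjac ht2
      rw [hJ] at this
      push_cast at this ⊢
      rw [this, sub_self]
    rw [ZMod.χ₈_nat_eq_if_mod_eight, if_neg (by omega)] at h8
    split_ifs at h8 <;> omega
  · rintro hq2 ⟨s, rfl⟩ ht2
    obtain ⟨m, rfl, hm, hma, ha2⟩ := heven ht2
    exact sixteen_dvd_dedekindNum hc hm ha2 (Nat.odd_mul.mp hq2).1 hma

theorem exists_numerator {q : ℕ} (hq : 0 < q) {a t : ℤ} (ht : 0 < t) (hdvd : t ∣ a ^ 2 + 1)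
    (hc : IsCoprime (a * q) t) :
    ∃ N : ℤ, S (a * q) t * t = N ∧ t ∣ ((q : ℤ) ^ 2 - 1) * a - q * N ∧ 3 ∣ N ∧
      (Odd q → Odd t → 4 ∣ N) ∧ (Odd q → Even t → 8 ∣ N) ∧
      (Odd q → IsSquare q → Odd t → 8 ∣ N) ∧ (Odd q → IsSquare q → Even t → 16 ∣ N) := by
  obtain ⟨k, rfl⟩ : ∃ k : ℕ, t = k := ⟨t.toNat, by omega⟩
  -- The claims depend only on `a` modulo `t`, so `a` may be shifted to a positive integer.
  obtain ⟨r, hr⟩ : ∃ r : ℤ, 0 < a + k * r := ⟨|a| + 1, by nlinarith [neg_abs_le a, abs_nonneg a]⟩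
  obtain ⟨b, hb⟩ : ∃ b : ℕ, a + k * r = b := ⟨(a + k * r).toNat, by omega⟩
  obtain rfl : a = b - k * r := by linarith
  have hk : 0 < k := by exact_mod_cast ht
  have hb0 : 0 < b := by omega
  have hdvd' : (k : ℤ) ∣ (b : ℤ) ^ 2 + 1 := by
    obtain ⟨u, hu⟩ := hdvd
    exact ⟨u + 2 * r * b - k * r ^ 2, by linear_combination hu⟩
  have hc' : (b * q).Coprime k := by
    refine Nat.isCoprime_iff_coprime.mp ?_
    have := hc.add_mul_left_left (r * q)
    rwa [show ((b : ℤ) - k * r) * q + k * (r * q) = ((b * q : ℕ) : ℤ) by push_cast; ring] at this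
  obtain ⟨h1, h2, h3, h4, h5, h6⟩ := dedekindNum_properties hb0 hq hk hdvd' hc'
  refine ⟨dedekindNum (b * q) k, ?_, ?_, h2, ?_, ?_, ?_, ?_⟩
  · have hS : S ((b - k * r) * q) k = S ((b * q : ℕ) : ℤ) k :=
      S_congr ht (Int.modEq_iff_dvd.mpr ⟨r * q, by push_cast; ring⟩)
    rw [hS, Int.cast_natCast, S_natCast_mul hc' hk]
  · obtain ⟨u, hu⟩ := h1
    exact ⟨u - ((q : ℤ) ^ 2 - 1) * r, by linear_combination hu⟩
  · exact_mod_cast h3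
  · exact_mod_cast h4
  · exact_mod_cast h5
  · exact_mod_cast h6

/-! ### From the numerator to the integer value. -/

theorem three_dvd_sq_sub_one {q : ℕ} (hq : ¬ 3 ∣ q) : (3 : ℤ) ∣ (q : ℤ) ^ 2 - 1 := by
  have : q % 3 = 1 ∨ q % 3 = 2 := by omega
  have e : (q : ℤ) ^ 2 - 1 = (q - 1) * (q + 1) := by ring
  rw [e]
  rcases this with h | h
  · exact Dvd.dvd.mul_right (by omega) _
  · exact Dvd.dvd.mul_left (by omega) _

theorem eight_dvd_sq_sub_one {q : ℕ} (hq : Odd q) : (8 : ℤ) ∣ (q : ℤ) ^ 2 - 1 :=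
  Int.eight_dvd_sq_sub_one_of_odd (by exact_mod_cast hq)

theorem sixteen_dvd_sq_sub_one {q : ℕ} (hq : Odd q) (hsq : IsSquare q) :
    (16 : ℤ) ∣ (q : ℤ) ^ 2 - 1 := by
  obtain ⟨s, rfl⟩ := hsq
  have hs : Odd (s : ℤ) := by exact_mod_cast (Nat.odd_mul.mp hq).1
  obtain ⟨w, hw⟩ := Int.eight_dvd_sq_sub_one_of_odd hs
  refine ⟨w * (4 * w + 1), ?_⟩
  push_cast
  linear_combination ((s : ℤ) ^ 2 + 1 + 8 * w) * hw

/-- In `t * n = (q² - 1) * a - q * N`, cancelling an even `t` costs exactly one factor 2; hence the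
need for 8 and 16 in place of 4 and 8. -/
theorem exists_int_value {q : ℕ} (hq : 0 < q) {a t : ℤ} (ht : 0 < t) (hdvd : t ∣ a ^ 2 + 1)
    (hc : IsCoprime (a * q) t) :
    ∃ n : ℤ, ((q : ℝ) ^ 2 - 1) * a / t - q * S (a * q) t = n ∧
      (¬ 3 ∣ q → 3 ∣ n) ∧ (Odd q → 4 ∣ n) ∧ (Odd q → IsSquare q → 8 ∣ n) := by
  obtain ⟨N, hN, ⟨n, hn⟩, h3, h4, h8, h8', h16⟩ := exists_numerator hq ht hdvd hc
  have ht0 : (t : ℝ) ≠ 0 := by exact_mod_cast ht.ne'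
  have two_mul_odd : Even t → ∃ m, t = 2 * m ∧ Odd m := by
    rintro ⟨m, rfl⟩
    refine ⟨m, by ring, ?_⟩
    by_contra h
    obtain ⟨r, rfl⟩ := Int.not_odd_iff_even.mp h
    exact not_four_dvd_sq_add_one a (Dvd.dvd.trans ⟨r, by ring⟩ hdvd)
  refine ⟨n, ?_, ?_, ?_, ?_⟩
  · have hn' := congrArg (Int.cast : ℤ → ℝ) hn
    push_cast at hn'
    rw [← hN] at hn'
    field_simp
    linear_combination hn'
  · intro hq3
    have hco : IsCoprime (3 : ℤ) t := (Prime.coprime_iff_not_dvd Int.prime_three).mpr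
      fun h => not_three_dvd_sq_add_one a (h.trans hdvd)
    refine hco.dvd_of_dvd_mul_left ?_
    rw [← hn]
    exact dvd_sub ((three_dvd_sq_sub_one hq3).mul_right _) (h3.mul_left _)
  · intro hq2
    have hd := eight_dvd_sq_sub_one hq2
    rcases Int.even_or_odd t with he | ho
    · obtain ⟨m, rfl, hm⟩ := two_mul_odd he
      have h : 8 ∣ 2 * m * n := by
        rw [← hn]
        exact dvd_sub (hd.mul_right _) ((h8 hq2 he).mul_left _)
      refine (isCoprime_two_pow_of_odd hm 2).dvd_of_dvd_mul_left ?_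
      rw [mul_assoc] at h
      omega
    · refine (isCoprime_two_pow_of_odd ho 2).dvd_of_dvd_mul_left ?_
      rw [← hn]
      exact dvd_sub ((Dvd.dvd.trans (by norm_num) hd).mul_right _) ((h4 hq2 ho).mul_left _)
  · intro hq2 hsq
    have hd := sixteen_dvd_sq_sub_one hq2 hsq
    rcases Int.even_or_odd t with he | ho
    · obtain ⟨m, rfl, hm⟩ := two_mul_odd he
      have h : 16 ∣ 2 * m * n := by
        rw [← hn]
        exact dvd_sub (hd.mul_right _) ((h16 hq2 hsq he).mul_left _)
      refine (isCoprime_two_pow_of_odd hm 3).dvd_of_dvd_mul_left ?_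
      rw [mul_assoc] at h
      omega
    · refine (isCoprime_two_pow_of_odd ho 3).dvd_of_dvd_mul_left ?_
      rw [← hn]
      exact dvd_sub ((Dvd.dvd.trans (by norm_num) hd).mul_right _) ((h8' hq2 hsq ho).mul_left _)

/-! ### Residues modulo `q² - 1`. -/

/-- Used with `e` equal to 4 or 8. Each of 3 and `e` either divides `n` or is a unit modulo `q² -
1`, since `q` is coprime to `q² - 1`. -/
theorem exists_multiple_zmod {q : ℕ} (hq : 2 ≤ q) {n e : ℤ} (h3 : ¬ 3 ∣ q → 3 ∣ n)
    (h2 : Odd q → e ∣ n) (he : IsCoprime (3 : ℤ) e)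
    (hunit : Even q → IsUnit (e : ZMod (q ^ 2 - 1))) :
    ∃ s : ZMod (q ^ 2 - 1), (n : ZMod (q ^ 2 - 1)) = 3 * (e : ZMod (q ^ 2 - 1)) * s := by
  have h3unit : 3 ∣ q → IsUnit (3 : ZMod (q ^ 2 - 1)) := by
    intro hq3
    have h1 : 1 ≤ q ^ 2 := Nat.one_le_pow _ _ (by omega)
    have h9 : 3 ∣ q ^ 2 := hq3.trans (dvd_pow_self q two_ne_zero)
    exact_mod_cast (ZMod.isUnit_iff_coprime 3 _).mpr
      ((Nat.Prime.coprime_iff_not_dvd Nat.prime_three).mpr (by omega))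
  by_cases hq3 : 3 ∣ q <;> rcases Nat.even_or_odd q with hev | hod
  · obtain ⟨x, hx⟩ := ((h3unit hq3).mul (hunit hev)).dvd (a := (n : ZMod (q ^ 2 - 1)))
    exact ⟨x, hx⟩
  · obtain ⟨m, rfl⟩ := h2 hod
    obtain ⟨x, hx⟩ := (h3unit hq3).dvd (a := (m : ZMod (q ^ 2 - 1)))
    exact ⟨x, by push_cast; rw [hx]; ring⟩
  · obtain ⟨m, rfl⟩ := h3 hq3
    obtain ⟨x, hx⟩ := (hunit hev).dvd (a := (m : ZMod (q ^ 2 - 1)))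
    exact ⟨x, by push_cast; rw [hx]; ring⟩
  · obtain ⟨m, rfl⟩ := he.mul_dvd (h3 hq3) (h2 hod)
    exact ⟨m, by push_cast; ring⟩

theorem isUnit_two_zmod {q : ℕ} (hq : 2 ≤ q) (hev : Even q) :
    IsUnit (2 : ZMod (q ^ 2 - 1)) := by
  have h1 : 1 ≤ q ^ 2 := Nat.one_le_pow _ _ (by omega)
  have hodd : Odd (q ^ 2 - 1) := Nat.Even.sub_odd h1 (hev.pow_of_ne_zero two_ne_zero) odd_one
  exact_mod_cast (ZMod.isUnit_iff_coprime 2 _).mpr (Nat.coprime_two_left.mpr hodd)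

theorem Lam_subset_Gam {q : ℕ} (hq : 2 ≤ q) : Lam q ⊆ Gam q := by
  rintro x ⟨a, t, n, hc, hdvd, ht, hn, rfl⟩
  obtain ⟨n', hn', h3, h4, h8⟩ := exists_int_value (by omega : 0 < q) ht hdvd hc
  obtain rfl : n' = n := by
    rw [hn] at hn'
    exact_mod_cast hn'.symm
  unfold Gam
  split_ifs with hsq
  · obtain ⟨s, hs⟩ := exists_multiple_zmod hq h3 (fun h => h8 h hsq) (by norm_num)
      (fun hev => by convert (isUnit_two_zmod hq hev).pow 3 using 1; norm_num)
    exact ⟨s, by rw [hs]; push_cast; ring⟩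
  · obtain ⟨s, hs⟩ := exists_multiple_zmod hq h3 h4 (by norm_num)
      (fun hev => by convert (isUnit_two_zmod hq hev).pow 2 using 1; norm_num)
    exact ⟨s, by rw [hs]; push_cast; ring⟩

end NormalizedDedekind

theorem mainTheorem5 (q : ℕ) (hq : 2 ≤ q) :
    (∀ a t : ℤ, 0 < t → t ∣ a ^ 2 + 1 → IsCoprime (a * q) t →
      ∃ n : ℤ, ((q : ℝ) ^ 2 - 1) * a / t - q * NormalizedDedekind.S (a * q) t = n) ∧
    NormalizedDedekind.Lam q ⊆ NormalizedDedekind.Gam q ∧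
    (∀ a t t' : ℤ, 0 < t → t ∣ a ^ 2 + 1 → t * t' ≡ 1 [ZMOD q] →
      ∃ n : ℤ, NormalizedDedekind.lam q a t t' = n ∧
        (¬ 3 ∣ q → 3 ∣ n) ∧
        (Odd q → 4 ∣ n) ∧
        (Odd q → IsSquare q → 8 ∣ n)) := by
  have hq0 : 0 < q := by omega
  refine ⟨fun a t ht hdvd hc => ?_, NormalizedDedekind.Lam_subset_Gam hq,
    fun a t t' ht hdvd hmod => ?_⟩
  · obtain ⟨n, hn, -⟩ := NormalizedDedekind.exists_int_value hq0 ht hdvd hc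
    exact ⟨n, hn⟩
  · have hc : IsCoprime (a * q) t := by
      obtain ⟨u, hu⟩ := hdvd
      obtain ⟨v, hv⟩ := hmod.dvd
      exact IsCoprime.mul_left ⟨-a, u, by linear_combination -hu⟩
        ⟨v, t', by linear_combination -hv⟩
    obtain ⟨n, hn, h3, h4, h8⟩ := NormalizedDedekind.exists_int_value hq0 ht hdvd hc
    -- The correction is a multiple of `q² - 1`, itself divisible by 3 if `3 ∤ q` and by 8 if `q` is
    -- odd.
    refine ⟨n - ((q : ℤ) ^ 2 - 1) * (a * t'), ?_, fun h => ?_, fun h => ?_, fun h h' => ?_⟩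
    · unfold NormalizedDedekind.lam
      push_cast
      linear_combination hn
    · exact dvd_sub (h3 h) ((NormalizedDedekind.three_dvd_sq_sub_one h).mul_right _)
    · exact dvd_sub (h4 h) ((Dvd.dvd.trans (by norm_num)
        (NormalizedDedekind.eight_dvd_sq_sub_one h)).mul_right _)
    · exact dvd_sub (h8 h h') ((NormalizedDedekind.eight_dvd_sq_sub_one h).mul_right _)
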